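/- Let $R$ be a real closed field, with its unique field ordering. Let $\mathbb{H}_R$ be the quaternion algebra over $R$, with basis $1,i,j,k$, and let $\mathbb{O}_R$ be the octonion algebra over $R$, with basis $1,e_1,\dots,e_7$ and multiplication $e_i^2=-1$, $e_ie_j=\epsilon_{ijk}e_k$ for $i\neq j$, where $\epsilon$ is completely antisymmetric with value $1$ on $ijk=123,145,176,246,257,347,365$. For $D=\mathbb{H}_R$ or $D=\mathbb{O}_R$, a one-variable ordered polynomial with coefficients in $D$ is a finite sum $p(q)=\sum_{n=0}^d q^n a_n$ with $a_n\in D$; it is non-constant if $a_n\neq 0$ for some $n\geq 1$. Its zero locus is $\mathcal{Z}_D(p)=\{q\in D : p(q)=0\}$. Let $\|\cdot\|^2$ denote the sum of the squares of the coordinates in the above bases. A point $z$ of a subset $Z\subseteq D$ is isolated in $Z$ if for some $r>0$ in $R$ there is no $w\in Z\setminus\{z\}$ with $\|w-z\|^2<r^2$. For $c\in R$ and $r>0$ in $R$, the sphere of $D$ with real center $c$ and radius $r$ is $\{q\in D : \mathrm{Re}(q)=c,\ \|q-c\|^2=r^2\}$; it is a $2$-sphere if $D=\mathbb{H}_R$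 and a $6$-sphere if $D=\mathbb{O}_R$. (Fundamental Theorem of Algebra.) Let $p$ and $p'$ be non-constant one-variable ordered polynomials with coefficients in $\mathbb{H}_R$ and $\mathbb{O}_R$, respectively. Then $\mathcal{Z}_{\mathbb{H}_R}(p)$ is non-empty, and it is the union of finitely many points isolated in $\mathcal{Z}_{\mathbb{H}_R}(p)$ and finitely many pairwise disjoint $2$-spheres with real centers. Moreover, $\mathcal{Z}_{\mathbb{O}_R}(p')$ is the union of finitely many points isolated in $\mathcal{Z}_{\mathbb{O}_R}(p')$ and finitely many pairwise disjoint $6$-spheres with real centers. -/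

import Mathlib

/-! ### Octonions over a commutative ring -/

/-- The octonions `𝕆_R` in the coordinates of the basis `1, e₁, …, e₇`:
`x` stands for `x.x0 + x.x1 e₁ + ⋯ + x.x7 e₇`. -/
@[ext]
structure Octonion (R : Type*) where
  x0 : R
  x1 : R
  x2 : R
  x3 : R
  x4 : R
  x5 : R
  x6 : R
  x7 : R

namespace Octonion

variable {R : Type*} [CommRing R]

instance : Zero (Octonion R) := ⟨⟨0, 0, 0, 0, 0, 0, 0, 0⟩⟩

instance : One (Octonion R) := ⟨⟨1, 0, 0, 0, 0, 0, 0, 0⟩⟩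

instance : Add (Octonion R) :=
  ⟨fun x y => ⟨x.x0 + y.x0, x.x1 + y.x1, x.x2 + y.x2, x.x3 + y.x3,
    x.x4 + y.x4, x.x5 + y.x5, x.x6 + y.x6, x.x7 + y.x7⟩⟩

instance : Neg (Octonion R) :=
  ⟨fun x => ⟨-x.x0, -x.x1, -x.x2, -x.x3, -x.x4, -x.x5, -x.x6, -x.x7⟩⟩

instance : Sub (Octonion R) :=
  ⟨fun x y => ⟨x.x0 - y.x0, x.x1 - y.x1, x.x2 - y.x2, x.x3 - y.x3,
    x.x4 - y.x4, x.x5 - y.x5, x.x6 - y.x6, x.x7 - y.x7⟩⟩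

/-- The bilinear multiplication with unit `1` for which `eᵢ² = -1` and `eᵢ eⱼ = ε_{ijk} e_k` for
`i ≠ j`, where `ε` is completely antisymmetric and equal to `1` on
`123, 145, 176, 246, 257, 347, 365`; see `Octonion.e_mul_self` and `Octonion.e_mul_e` below. -/
instance : Mul (Octonion R) :=
  ⟨fun x y =>
   { x0 := x.x0 * y.x0 - x.x1 * y.x1 - x.x2 * y.x2 - x.x3 * y.x3
        - x.x4 * y.x4 - x.x5 * y.x5 - x.x6 * y.x6 - x.x7 * y.x7
     x1 := x.x0 * y.x1 + x.x1 * y.x0 + x.x2 * y.x3 - x.x3 * y.x2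
        + x.x4 * y.x5 - x.x5 * y.x4 - x.x6 * y.x7 + x.x7 * y.x6
     x2 := x.x0 * y.x2 - x.x1 * y.x3 + x.x2 * y.x0 + x.x3 * y.x1
        + x.x4 * y.x6 + x.x5 * y.x7 - x.x6 * y.x4 - x.x7 * y.x5
     x3 := x.x0 * y.x3 + x.x1 * y.x2 - x.x2 * y.x1 + x.x3 * y.x0
        + x.x4 * y.x7 - x.x5 * y.x6 + x.x6 * y.x5 - x.x7 * y.x4
     x4 := x.x0 * y.x4 - x.x1 * y.x5 - x.x2 * y.x6 - x.x3 * y.x7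
        + x.x4 * y.x0 + x.x5 * y.x1 + x.x6 * y.x2 + x.x7 * y.x3
     x5 := x.x0 * y.x5 + x.x1 * y.x4 - x.x2 * y.x7 + x.x3 * y.x6
        - x.x4 * y.x1 + x.x5 * y.x0 - x.x6 * y.x3 + x.x7 * y.x2
     x6 := x.x0 * y.x6 + x.x1 * y.x7 + x.x2 * y.x4 - x.x3 * y.x5
        - x.x4 * y.x2 + x.x5 * y.x3 + x.x6 * y.x0 - x.x7 * y.x1
     x7 := x.x0 * y.x7 - x.x1 * y.x6 + x.x2 * y.x5 + x.x3 * y.x4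
        - x.x4 * y.x3 - x.x5 * y.x2 + x.x6 * y.x1 + x.x7 * y.x0 }⟩

theorem zero_def : (0 : Octonion R) = ⟨0, 0, 0, 0, 0, 0, 0, 0⟩ := rfl

theorem one_def : (1 : Octonion R) = ⟨1, 0, 0, 0, 0, 0, 0, 0⟩ := rfl

theorem add_def (x y : Octonion R) : x + y = ⟨x.x0 + y.x0, x.x1 + y.x1, x.x2 + y.x2, x.x3 + y.x3,
    x.x4 + y.x4, x.x5 + y.x5, x.x6 + y.x6, x.x7 + y.x7⟩ := rfl

theorem neg_def (x : Octonion R) :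
    -x = ⟨-x.x0, -x.x1, -x.x2, -x.x3, -x.x4, -x.x5, -x.x6, -x.x7⟩ := rfl

theorem sub_def (x y : Octonion R) : x - y = ⟨x.x0 - y.x0, x.x1 - y.x1, x.x2 - y.x2, x.x3 - y.x3,
    x.x4 - y.x4, x.x5 - y.x5, x.x6 - y.x6, x.x7 - y.x7⟩ := rfl

theorem mul_def (x y : Octonion R) : x * y =
   { x0 := x.x0 * y.x0 - x.x1 * y.x1 - x.x2 * y.x2 - x.x3 * y.x3
        - x.x4 * y.x4 - x.x5 * y.x5 - x.x6 * y.x6 - x.x7 * y.x7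
     x1 := x.x0 * y.x1 + x.x1 * y.x0 + x.x2 * y.x3 - x.x3 * y.x2
        + x.x4 * y.x5 - x.x5 * y.x4 - x.x6 * y.x7 + x.x7 * y.x6
     x2 := x.x0 * y.x2 - x.x1 * y.x3 + x.x2 * y.x0 + x.x3 * y.x1
        + x.x4 * y.x6 + x.x5 * y.x7 - x.x6 * y.x4 - x.x7 * y.x5
     x3 := x.x0 * y.x3 + x.x1 * y.x2 - x.x2 * y.x1 + x.x3 * y.x0
        + x.x4 * y.x7 - x.x5 * y.x6 + x.x6 * y.x5 - x.x7 * y.x4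
     x4 := x.x0 * y.x4 - x.x1 * y.x5 - x.x2 * y.x6 - x.x3 * y.x7
        + x.x4 * y.x0 + x.x5 * y.x1 + x.x6 * y.x2 + x.x7 * y.x3
     x5 := x.x0 * y.x5 + x.x1 * y.x4 - x.x2 * y.x7 + x.x3 * y.x6
        - x.x4 * y.x1 + x.x5 * y.x0 - x.x6 * y.x3 + x.x7 * y.x2
     x6 := x.x0 * y.x6 + x.x1 * y.x7 + x.x2 * y.x4 - x.x3 * y.x5
        - x.x4 * y.x2 + x.x5 * y.x3 + x.x6 * y.x0 - x.x7 * y.x1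
     x7 := x.x0 * y.x7 - x.x1 * y.x6 + x.x2 * y.x5 + x.x3 * y.x4
        - x.x4 * y.x3 - x.x5 * y.x2 + x.x6 * y.x1 + x.x7 * y.x0 } := rfl

instance : NonAssocRing (Octonion R) where
  add_assoc x y z := by ext <;> simp only [add_def] <;> ring
  zero_add x := by ext <;> simp only [add_def, zero_def] <;> ring
  add_zero x := by ext <;> simp only [add_def, zero_def] <;> ring
  add_comm x y := by ext <;> simp only [add_def] <;> ring
  neg_add_cancel x := by ext <;> simp only [add_def, neg_def, zero_def] <;> ring
  sub_eq_add_neg x y := by ext <;> simp only [add_def, neg_def, sub_def] <;> ring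
  nsmul := nsmulRec
  zsmul := zsmulRec
  left_distrib x y z := by ext <;> simp only [add_def, mul_def] <;> ring
  right_distrib x y z := by ext <;> simp only [add_def, mul_def] <;> ring
  zero_mul x := by ext <;> simp only [mul_def, zero_def] <;> ring
  mul_zero x := by ext <;> simp only [mul_def, zero_def] <;> ring
  one_mul x := by ext <;> simp only [mul_def, one_def] <;> ring
  mul_one x := by ext <;> simp only [mul_def, one_def] <;> ring

/-- The octonion `r · 1` for `r : R`. -/
def ofScalar (r : R) : Octonion R := ⟨r, 0, 0, 0, 0, 0, 0, 0⟩

/-- The squared Euclidean norm of an octonion. -/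
def normSq (x : Octonion R) : R :=
  x.x0 ^ 2 + x.x1 ^ 2 + x.x2 ^ 2 + x.x3 ^ 2 + x.x4 ^ 2 + x.x5 ^ 2 + x.x6 ^ 2 + x.x7 ^ 2

/-- The basis `e₀ = 1, e₁, …, e₇`. -/
def e (R : Type*) [CommRing R] (i : Fin 8) : Octonion R :=
  ⟨if i = 0 then 1 else 0, if i = 1 then 1 else 0, if i = 2 then 1 else 0, if i = 3 then 1 else 0,
    if i = 4 then 1 else 0, if i = 5 then 1 else 0, if i = 6 then 1 else 0, if i = 7 then 1 else 0⟩

/-- The oriented lines `ijk` on which `ε_{ijk} = 1`. -/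
def lines : List (Fin 8 × Fin 8 × Fin 8) :=
  [(1, 2, 3), (1, 4, 5), (1, 7, 6), (2, 4, 6), (2, 5, 7), (3, 4, 7), (3, 6, 5)]

theorem e_mul_self (i : Fin 8) (hi : i ≠ 0) : e R i * e R i = -1 := by
  fin_cases i <;> first | exact absurd rfl hi | (ext <;> simp [e, mul_def, neg_def, one_def])

theorem e_mul_e (i j k : Fin 8) (h : (i, j, k) ∈ lines) :
    e R i * e R j = e R k ∧ e R j * e R k = e R i ∧ e R k * e R i = e R j ∧
    e R j * e R i = -e R k ∧ e R k * e R j = -e R i ∧ e R i * e R k = -e R j := by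
  have h1 : e R 1 = ⟨0, 1, 0, 0, 0, 0, 0, 0⟩ := by simp [e]
  have h2 : e R 2 = ⟨0, 0, 1, 0, 0, 0, 0, 0⟩ := by simp [e]
  have h3 : e R 3 = ⟨0, 0, 0, 1, 0, 0, 0, 0⟩ := by simp [e]
  have h4 : e R 4 = ⟨0, 0, 0, 0, 1, 0, 0, 0⟩ := by simp [e]
  have h5 : e R 5 = ⟨0, 0, 0, 0, 0, 1, 0, 0⟩ := by simp [e]
  have h6 : e R 6 = ⟨0, 0, 0, 0, 0, 0, 1, 0⟩ := by simp [e]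
  have h7 : e R 7 = ⟨0, 0, 0, 0, 0, 0, 0, 1⟩ := by simp [e]
  simp only [lines, List.mem_cons, Prod.mk.injEq, List.not_mem_nil, or_false] at h
  rcases h with ⟨rfl, rfl, rfl⟩ | ⟨rfl, rfl, rfl⟩ | ⟨rfl, rfl, rfl⟩ | ⟨rfl, rfl, rfl⟩ |
    ⟨rfl, rfl, rfl⟩ | ⟨rfl, rfl, rfl⟩ | ⟨rfl, rfl, rfl⟩ <;>
  simp only [h1, h2, h3, h4, h5, h6, h7, mul_def, neg_def, mul_zero, mul_one,
    add_zero, zero_add, sub_zero, zero_sub, neg_zero, and_self]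

end Octonion

/-! ### Ordered polynomials in one variable -/

/-- A one-variable ordered polynomial `∑ₙ qⁿ aₙ` (finite sum, coefficients on the right of the
variable) with coefficients in `D`, given by its coefficients `n ↦ aₙ`. -/
abbrev OrderedPoly (D : Type*) [Zero D] := ℕ →₀ D

namespace OrderedPoly

variable {D : Type*} [NonAssocRing D]

/-- The power `xⁿ` in a ring that need not be associative: `x⁰ = 1`, `xⁿ⁺¹ = xⁿ x`. -/
def power (x : D) : ℕ → D
  | 0 => 1
  | n + 1 => power x n * x

theorem power_eq_pow {A : Type*} [Ring A] (x : A) (n : ℕ) : power x n = x ^ n := by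
  induction n with
  | zero => simp [power]
  | succ n ih => rw [power, ih, pow_succ]

/-- The value `∑ₙ xⁿ aₙ` of an ordered polynomial at `x`. -/
def eval (p : OrderedPoly D) (x : D) : D := p.sum fun n a => power x n * a

/-- A polynomial is non-constant if some coefficient of positive degree is nonzero. -/
def IsNonconstant (p : OrderedPoly D) : Prop := ∃ n, 0 < n ∧ p n ≠ 0

/-- The zero locus of an ordered polynomial. -/
def zeroLocus (p : OrderedPoly D) : Set D := {x | p.eval x = 0}

end OrderedPoly

/-! ### Isolated points and spheres -/

/-- The 2-sphere in `ℍ_R` with real center `c` and radius `r`: the points with real part `c`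
(a 3-dimensional affine subspace) at distance `r` from `c`. -/
def quaternionSphere {R : Type*} [CommRing R] (c r : R) : Set (Quaternion R) :=
  {q | q.re = c ∧ Quaternion.normSq (q - (c : Quaternion R)) = r ^ 2}

/-- The 6-sphere in `𝕆_R` with real center `c` and radius `r`: the points with real part `c`
(a 7-dimensional affine subspace) at distance `r` from `c`. -/
def octonionSphere {R : Type*} [CommRing R] (c r : R) : Set (Octonion R) :=
  {o | o.x0 = c ∧ Octonion.normSq (o - Octonion.ofScalar c) = r ^ 2}

/-- `z` is an isolated point of `Z` for the Euclidean topology with squared norm `N`: it lies in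
`Z`, and some open ball of positive radius around it contains no other point of `Z`. -/
def IsIsolatedPointOf {R D : Type*} [Field R] [LinearOrder R] [Sub D]
    (N : D → R) (Z : Set D) (z : D) : Prop :=
  z ∈ Z ∧ ∃ r : R, 0 < r ∧ ∀ w ∈ Z, N (w - z) < r ^ 2 → w = z

/-- `Z` is the union of finitely many isolated points of `Z` and finitely many pairwise disjoint
spheres `sphere c r`, with `c` in `R` and `r > 0` in `R`. -/
def IsFiniteUnionOfPointsAndSpheres {R D : Type*} [Field R] [LinearOrder R] [Sub D]
    (N : D → R) (sphere : R → R → Set D) (Z : Set D) : Prop :=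
  ∃ (P : Finset D) (S : Finset (R × R)),
    (∀ z ∈ P, IsIsolatedPointOf N Z z) ∧
    (∀ s ∈ S, 0 < s.2) ∧
    (S : Set (R × R)).PairwiseDisjoint (fun s => sphere s.1 s.2) ∧
    Z = (P : Set D) ∪ ⋃ s ∈ S, sphere s.1 s.2

/-! Every octonion `q` satisfies `q² = 2cq - n`, with `c` its real part and `n` its squared norm.
Write `Δ = X² - 2cX + n`, let `P` be the polynomial `p` with a central variable, and divide: `P = ΔQ
+ A + XB`. Then `p(q) = A + qB` at every `q` of the class `(c, n)` (`exists_eval_eq`), while `N(P)`,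
a sum of squares of real polynomials, is congruent to `N(A) + 2⟨A,B⟩X + N(B)X²` modulo `Δ`
(`normSq_division`).

A zero in the class gives `A = -qB`, which forces `Δ ∣ N(P)`. As `N(P)` is nonzero, only finitely
many classes contain zeros. Octonions have no zero divisors, so a class has at most one zero if `B ≠
0`; if `B = 0` it consists of zeros or has none. This gives the points and the spheres, and the
points are isolated because the other finitely many classes lie at positive distance.

For existence over the quaternions, irreducible real polynomials have degree at most two
(`natDegree_le_two_of_irreducible`), so the non-constant `N(P)` has a divisor `Δ` with `n ≥ c²`. If
`B ≠ 0`, then `-A B̄ / N(B)` lies in the class and is a zero; if `B = 0`, then `A = 0` and the whole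
class vanishes. The quaternionic statements are pulled back from the octonions along the isometric
embedding. -/

/-! ### Real closed fields: irreducible polynomials, by Galois theory and Sylow subgroups -/

namespace IsRealClosed

open Polynomial IntermediateField

variable {R : Type*} [Field R]

/-- If `i ^ 2 = -1`, then every element of `R(i)` has the form `a + b i`. -/
theorem exists_eq_add_mul_of_mem_adjoin {E : Type*} [Field E] [Algebra R E] {i : E}
    (hi : i ^ 2 = -1) {z : E} (hz : z ∈ R⟮i⟯) :
    ∃ a b : R, z = algebraMap R E a + algebraMap R E b * i := by
  have hmonic : (X ^ 2 + 1 : R[X]).Monic := by monicity!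
  have hroot : aeval i (X ^ 2 + 1 : R[X]) = 0 := by simp [hi]
  have hint : IsIntegral R i := ⟨_, hmonic, by simpa [aeval_def] using hroot⟩
  have hz' : z ∈ Algebra.adjoin R {i} := by
    rw [← IntermediateField.adjoin_simple_toSubalgebra_of_isAlgebraic hint.isAlgebraic]
    exact hz
  rw [Algebra.adjoin_singleton_eq_range_aeval] at hz'
  obtain ⟨f, rfl⟩ := hz'
  have hdeg : (f %ₘ (X ^ 2 + 1)).natDegree ≤ 1 := by
    have h2 : (X ^ 2 + 1 : R[X]).natDegree = 2 := by compute_degree!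
    have := natDegree_modByMonic_lt f hmonic (fun h => by rw [h] at h2; simp at h2)
    omega
  obtain ⟨b, a, hab⟩ := exists_eq_X_add_C_of_natDegree_le_one hdeg
  refine ⟨a, b, ?_⟩
  change aeval i f = _
  conv_lhs => rw [← modByMonic_add_div f (X ^ 2 + 1)]
  rw [map_add, map_mul, hroot, zero_mul, add_zero, hab]
  simp [add_comm]

/-- A field of characteristic different from two all of whose elements are squares has no
extension of degree two. -/
theorem finrank_ne_two_of_isSquare {K M : Type*} [Field K] [NeZero (2 : K)] [Field M] [Algebra K M]
    (hK : ∀ z : K, IsSquare z) : Module.finrank K M ≠ 2 := by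
  intro h
  have : FiniteDimensional K M := FiniteDimensional.of_finrank_pos (by omega)
  have hroot : ∀ α : M, α ∈ (⊥ : IntermediateField K M) := by
    intro α
    have hint : IsIntegral K α := Algebra.IsIntegral.isIntegral α
    have hdvd : (minpoly K α).natDegree ∣ 2 := h ▸ minpoly.degree_dvd hint
    rcases (Nat.dvd_prime Nat.prime_two).mp hdvd with h1 | h2
    · exact IntermediateField.mem_bot.mpr (minpoly.natDegree_eq_one_iff.mp h1)
    · exfalso
      have hmon := minpoly.monic hint
      have hcoef : (minpoly K α).coeff 2 = 1 := by rw [← h2]; exact hmon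
      obtain ⟨s, hs⟩ := hK (discrim 1 ((minpoly K α).coeff 1) ((minpoly K α).coeff 0))
      obtain ⟨x, hx⟩ := exists_quadratic_eq_zero (one_ne_zero (α := K)) ⟨s, hs⟩
      have hxr : (minpoly K α).IsRoot x := by
        rw [IsRoot, eval_eq_sum_range, h2]
        simp only [Finset.sum_range_succ, Finset.sum_range_zero, hcoef]
        linear_combination hx
      have := degree_eq_one_of_irreducible_of_root (minpoly.irreducible hint) hxr
      have := natDegree_eq_of_degree_eq_some this
      exact absurd (h2.symm.trans this) (by norm_num)
  have htop : (⊥ : IntermediateField K M) = ⊤ := by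
    ext x; simp [hroot x]
  have := IntermediateField.finrank_bot (F := K) (E := M)
  rw [htop, IntermediateField.finrank_top'] at this
  omega

variable [LinearOrder R] [IsStrictOrderedRing R] [IsRealClosed R]

/-- A real closed field has no proper extension of odd degree. -/
theorem finrank_eq_one_of_odd {K : Type*} [Field K] [Algebra R K] [FiniteDimensional R K]
    (h : Odd (Module.finrank R K)) : Module.finrank R K = 1 := by
  obtain ⟨α, hα⟩ := Field.exists_primitive_element R K
  have hint : IsIntegral R α := Algebra.IsIntegral.isIntegral α
  have hdeg : (minpoly R α).natDegree = Module.finrank R K := by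
    rw [← IntermediateField.adjoin.finrank hint, hα, IntermediateField.finrank_top']
  obtain ⟨x, hx⟩ := exists_isRoot_of_odd_natDegree (f := minpoly R α) (hdeg ▸ h)
  rw [← hdeg]
  exact natDegree_eq_of_degree_eq_some (degree_eq_one_of_irreducible_of_root
    (minpoly.irreducible hint) hx)

/-- A finite Galois extension of a real closed field has degree a power of two. -/
theorem exists_finrank_eq_two_pow (E : Type*) [Field E] [Algebra R E] [FiniteDimensional R E]
    [IsGalois R E] : ∃ k, Module.finrank R E = 2 ^ k := by
  obtain ⟨H⟩ : Nonempty (Sylow 2 Gal(E/R)) := inferInstance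
  obtain ⟨k, hk⟩ := IsPGroup.iff_card.mp H.isPGroup'
  refine ⟨k, ?_⟩
  have hfix : Module.finrank (fixedField (H : Subgroup Gal(E/R))) E = 2 ^ k := by
    rw [IntermediateField.finrank_fixedField_eq_card]
    exact hk
  have hmul := Module.finrank_mul_finrank R (fixedField (H : Subgroup Gal(E/R))) E
  have hindex : Module.finrank R (fixedField (H : Subgroup Gal(E/R))) =
      (H : Subgroup Gal(E/R)).index := by
    have hcard := (H : Subgroup Gal(E/R)).card_mul_index
    rw [IsGalois.card_aut_eq_finrank, ← hmul, hfix, hk, mul_comm] at hcard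
    exact (Nat.eq_of_mul_eq_mul_right (by positivity) hcard).symm
  -- The degree of the fixed field is the index of a Sylow 2-subgroup, hence odd.
  have hone : Module.finrank R (fixedField (H : Subgroup Gal(E/R))) = 1 := by
    apply finrank_eq_one_of_odd
    rw [hindex, ← Nat.not_even_iff_odd, even_iff_two_dvd]
    exact H.not_dvd_index
  rw [← hmul, hone, one_mul, hfix]

/-- If `i ^ 2 = -1`, then every element `a + b i` is a square of such an element. -/
theorem exists_sq_eq {E : Type*} [Field E] [Algebra R E] {i : E} (hi : i ^ 2 = -1) (a b : R) :
    ∃ c d : R, (algebraMap R E c + algebraMap R E d * i) ^ 2 =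
      algebraMap R E a + algebraMap R E b * i := by
  obtain ⟨m, hm⟩ := exists_eq_pow_of_nonneg (x := a ^ 2 + b ^ 2) (by positivity) two_ne_zero
  -- With `m = √(a² + b²) ≥ |a|`, the half-angle formulas `c² = (m + a)/2` and `d² = (m - a)/2` make
  -- sense; they determine `2cd = b` only up to sign.
  wlog hm0 : 0 ≤ m generalizing m
  · exact this (-m) (by rw [hm]; ring) (by linarith)
  have hle : |a| ≤ m := abs_le_of_sq_le_sq (by nlinarith [sq_nonneg b]) hm0
  obtain ⟨h1, h2⟩ := abs_le.mp hle
  obtain ⟨c, hc⟩ := exists_eq_pow_of_nonneg (x := (m + a) / 2) (by linarith) two_ne_zero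
  obtain ⟨d, hd⟩ := exists_eq_pow_of_nonneg (x := (m - a) / 2) (by linarith) two_ne_zero
  have hcd : (2 * c * d) ^ 2 = b ^ 2 := by
    have : (2 * c * d) ^ 2 = 4 * c ^ 2 * d ^ 2 := by ring
    rw [this, ← hc, ← hd]
    linear_combination -hm
  have key : ∀ d' : R, d' ^ 2 = d ^ 2 → 2 * c * d' = b →
      (algebraMap R E c + algebraMap R E d' * i) ^ 2 =
      algebraMap R E a + algebraMap R E b * i := by
    intro d' hd' hb
    have ha : c ^ 2 - d' ^ 2 = a := by rw [hd', ← hc, ← hd]; ring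
    rw [← ha, ← hb]
    simp only [map_sub, map_mul, map_pow, map_ofNat]
    linear_combination (algebraMap R E d') ^ 2 * hi
  rcases sq_eq_sq_iff_eq_or_eq_neg.mp hcd with h | h
  · exact ⟨c, d, key d rfl h⟩
  · exact ⟨c, -d, key (-d) (by ring) (by linear_combination -h)⟩

/-- Irreducible polynomials over a real closed field have degree at most two. -/
theorem natDegree_le_two_of_irreducible {f : R[X]} (hf : Irreducible f) : f.natDegree ≤ 2 := by
  -- The extra factor puts a square root `i` of `-1` in the splitting field.
  let g : R[X] := f * (X ^ 2 + 1)
  have hmonic : (X ^ 2 + 1 : R[X]).Monic := by monicity!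
  have hdeg2 : (X ^ 2 + 1 : R[X]).natDegree = 2 := by compute_degree!
  have hg0 : g ≠ 0 := mul_ne_zero hf.ne_zero hmonic.ne_zero
  let E := g.SplittingField
  have : IsGalois R E := { }
  have hsplit : (g.map (algebraMap R E)).Splits := SplittingField.splits g
  have hmap0 : g.map (algebraMap R E) ≠ 0 := by
    rwa [Ne, Polynomial.map_eq_zero]
  have hroots : ∀ u : R[X], u ∣ g → 0 < u.natDegree → ∃ x : E, aeval x u = 0 := by
    intro u hu hu0
    have hs : (u.map (algebraMap R E)).Splits := hsplit.of_dvd hmap0 (Polynomial.map_dvd _ hu)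
    obtain ⟨x, hx⟩ := hs.exists_eval_eq_zero (by
      rw [degree_map]; exact (natDegree_pos_iff_degree_pos.mp hu0).ne')
    exact ⟨x, by rwa [eval_map_algebraMap] at hx⟩
  obtain ⟨β, hβ⟩ := hroots f (dvd_mul_right _ _) hf.natDegree_pos
  obtain ⟨i, hi⟩ := hroots (X ^ 2 + 1) (dvd_mul_left _ _) (by omega)
  have hi2 : i ^ 2 = -1 := by
    have : i ^ 2 + 1 = 0 := by simpa using hi
    linear_combination this
  have hsq : ∀ z : R⟮i⟯, IsSquare z := by
    rintro ⟨z, hz⟩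
    obtain ⟨a, b, rfl⟩ := exists_eq_add_mul_of_mem_adjoin hi2 hz
    obtain ⟨c, d, hcd⟩ := exists_sq_eq (E := E) hi2 a b
    refine ⟨⟨algebraMap R E c + algebraMap R E d * i, ?_⟩, ?_⟩
    · exact add_mem (_root_.algebraMap_mem _ _) (mul_mem (_root_.algebraMap_mem _ _)
        (mem_adjoin_simple_self R i))
    · exact Subtype.ext (hcd.symm.trans (sq _))
  have hK : Module.finrank R R⟮i⟯ ≤ 2 := by
    have hint : IsIntegral R i := ⟨_, hmonic, by simpa [aeval_def] using hi⟩
    rw [IntermediateField.adjoin.finrank hint, ← hdeg2]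
    exact natDegree_le_of_dvd (minpoly.dvd R i hi) hmonic.ne_zero
  have htower := Module.finrank_mul_finrank R R⟮i⟯ E
  have hone : Module.finrank R⟮i⟯ E = 1 := by
    obtain ⟨k, hk⟩ := exists_finrank_eq_two_pow (R := R) E
    obtain ⟨j, -, hj⟩ := (Nat.dvd_prime_pow Nat.prime_two).mp
      (hk ▸ Dvd.intro_left _ htower : Module.finrank R⟮i⟯ E ∣ 2 ^ k)
    rcases j with _ | j
    · simpa using hj
    exfalso
    have : Fact (Nat.Prime 2) := ⟨Nat.prime_two⟩
    -- `H` has index two in a group of order `2 ^ (j + 1)`, so its fixed field would be a quadratic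
    -- extension of `R(i)`, where every element is a square.
    obtain ⟨H, hH⟩ := Sylow.exists_subgroup_card_pow_prime (G := Gal(E/R⟮i⟯)) 2 (n := j) (by
      rw [IsGalois.card_aut_eq_finrank, hj]; exact pow_dvd_pow 2 (Nat.le_succ j))
    have h1 : Module.finrank (fixedField H) E = 2 ^ j := by
      rw [IntermediateField.finrank_fixedField_eq_card, hH]
    have h2 := Module.finrank_mul_finrank R⟮i⟯ (fixedField H) E
    rw [h1, hj, pow_succ, mul_comm (2 ^ j)] at h2
    have : CharZero R⟮i⟯ := charZero_of_injective_algebraMap (algebraMap R R⟮i⟯).injective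
    exact finrank_ne_two_of_isSquare hsq (Nat.eq_of_mul_eq_mul_right (by positivity) h2)
  have hE : Module.finrank R E ≤ 2 := by rw [← htower, hone, mul_one]; exact hK
  have hmin : f.natDegree = (minpoly R β).natDegree := by
    have := minpoly.eq_of_irreducible hf hβ
    rw [← this, natDegree_mul_C (inv_ne_zero (leadingCoeff_ne_zero.mpr hf.ne_zero))]
  rw [hmin]
  exact (minpoly.natDegree_le β).trans hE

end IsRealClosed

/-! ### Octonion identities and division by a characteristic polynomial -/

namespace Octonion

section CommRing

variable {R : Type*} [CommRing R]

/-- The bilinear form whose quadratic form is `normSq`. -/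
def dot (x y : Octonion R) : R :=
  x.x0 * y.x0 + x.x1 * y.x1 + x.x2 * y.x2 + x.x3 * y.x3 +
    x.x4 * y.x4 + x.x5 * y.x5 + x.x6 * y.x6 + x.x7 * y.x7

/-- Octonionic conjugation. -/
def conj (x : Octonion R) : Octonion R :=
  ⟨x.x0, -x.x1, -x.x2, -x.x3, -x.x4, -x.x5, -x.x6, -x.x7⟩

/-- Application of a function to all coordinates. -/
def map {S : Type*} (f : R → S) (x : Octonion R) : Octonion S :=
  ⟨f x.x0, f x.x1, f x.x2, f x.x3, f x.x4, f x.x5, f x.x6, f x.x7⟩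

theorem mul_self_eq (q : Octonion R) :
    q * q = ofScalar (2 * q.x0) * q - ofScalar (normSq q) := by
  ext <;> simp only [mul_def, sub_def, ofScalar, normSq] <;> ring

/-- The eight-square identity, which makes the octonions a composition algebra. -/
theorem normSq_mul (x y : Octonion R) : normSq (x * y) = normSq x * normSq y := by
  simp only [mul_def, normSq]; ring

theorem normSq_neg (x : Octonion R) : normSq (-x) = normSq x := by
  simp only [neg_def, normSq]; ring

theorem normSq_conj (x : Octonion R) : normSq (conj x) = normSq x := by
  simp only [conj, normSq]; ring

theorem normSq_ofScalar (r : R) : normSq (ofScalar r) = r ^ 2 := by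
  simp only [ofScalar, normSq]; ring

theorem dot_neg_mul (x y : Octonion R) : dot (-(x * y)) y = -(x.x0 * normSq y) := by
  simp only [mul_def, neg_def, normSq, dot]; ring

/-- An instance of alternativity, `(x ȳ) y = N(y) x`; it is what allows solving `q y = x` for `q`
without associativity. -/
theorem ofScalar_mul_mul_conj_mul (r : R) (x y : Octonion R) :
    (ofScalar r * (x * conj y)) * y = ofScalar (r * normSq y) * x := by
  ext <;> simp only [mul_def, conj, ofScalar, normSq] <;> ring

theorem x0_ofScalar_mul_mul_conj (r : R) (x y : Octonion R) :
    (ofScalar r * (x * conj y)).x0 = r * dot x y := by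
  simp only [mul_def, conj, ofScalar, dot]; ring

theorem normSq_add (x y : Octonion R) :
    normSq (x + y) = normSq x + 2 * dot x y + normSq y := by
  simp only [add_def, normSq, dot]; ring

theorem normSq_sub_ofScalar (c : R) (q : Octonion R) (h : q.x0 = c) :
    normSq (q - ofScalar c) = normSq q - c ^ 2 := by
  simp only [sub_def, normSq, ofScalar, ← h]; ring

/-- Real scalars commute and associate with everything, so the coefficient can be gathered to the
right of `q`. -/
theorem add_mul_ofScalar_comm (α β : R) (q a : Octonion R) :
    (ofScalar α + ofScalar β * q) * a = ofScalar α * a + q * (ofScalar β * a) := by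
  ext <;> simp only [mul_def, add_def, ofScalar] <;> ring

theorem ofScalar_recurrence (α β t n : R) (q : Octonion R)
    (hq : q * q = ofScalar t * q - ofScalar n) :
    (ofScalar α + ofScalar β * q) * q = ofScalar (-n * β) + ofScalar (α + t * β) * q := by
  have h1 : (ofScalar α + ofScalar β * q) * q = ofScalar α * q + ofScalar β * (q * q) := by
    ext <;> simp only [mul_def, add_def, ofScalar] <;> ring
  rw [h1, hq]
  ext <;> simp only [mul_def, add_def, sub_def, ofScalar] <;> ring

open Polynomial

/-- The characteristic polynomial `X ^ 2 - 2 c X + n` shared by the octonions with real part `c`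
and squared norm `n`. -/
noncomputable def charPoly (c n : R) : R[X] := X ^ 2 - C (2 * c) * X + C n

/-- The reduction of `X ^ m` modulo the characteristic polynomial also computes `q ^ m`, uniformly
over the class: both obey the recurrence coming from `X² = 2cX - n`. -/
theorem exists_power_eq (c n : R) (m : ℕ) : ∃ (α β : R) (g : R[X]),
    X ^ m = charPoly c n * g + C α + C β * X ∧
    ∀ q : Octonion R, q.x0 = c → normSq q = n →
      OrderedPoly.power q m = ofScalar α + ofScalar β * q := by
  induction m with
  | zero =>
    refine ⟨1, 0, 0, by simp, fun q _ _ => ?_⟩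
    ext <;> simp [OrderedPoly.power, mul_def, add_def, ofScalar, one_def]
  | succ m ih =>
    obtain ⟨α, β, g, hg, hq⟩ := ih
    refine ⟨-n * β, α + 2 * c * β, X * g + C β, ?_, fun q h0 h1 => ?_⟩
    · rw [pow_succ, hg]
      simp only [charPoly, map_add, map_mul, map_neg, map_ofNat]
      ring
    · rw [OrderedPoly.power, hq q h0 h1]
      exact ofScalar_recurrence _ _ _ _ _ (by rw [← h0, ← h1]; exact mul_self_eq q)

/-- The octonion with polynomial coordinates attached to an ordered polynomial. -/
noncomputable def toPoly (p : OrderedPoly (Octonion R)) : Octonion R[X] :=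
  p.sum fun n a => ofScalar (X ^ n) * map C a

theorem toPoly_zero : toPoly (0 : OrderedPoly (Octonion R)) = 0 := Finsupp.sum_zero_index

theorem map_C_zero : map C (0 : Octonion R) = 0 := by
  ext <;> simp [map, zero_def]

theorem map_C_add (a b : Octonion R) : map C (a + b) = map C a + map C b := by
  ext1 <;> simp [map, add_def]

theorem map_C_ofScalar_mul (r : R) (a : Octonion R) :
    map C (ofScalar r * a) = ofScalar (C r) * map C a := by
  ext1 <;> simp [map, mul_def, ofScalar]

theorem toPoly_add (p q : OrderedPoly (Octonion R)) : toPoly (p + q) = toPoly p + toPoly q :=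
  Finsupp.sum_add_index' (fun _ => by rw [map_C_zero, mul_zero])
    (fun _ _ _ => by rw [map_C_add, mul_add])

theorem toPoly_single (n : ℕ) (a : Octonion R) :
    toPoly (Finsupp.single n a) = ofScalar (X ^ n) * map C a :=
  Finsupp.sum_single_index (by rw [map_C_zero, mul_zero])

theorem eval_add (p q : OrderedPoly (Octonion R)) (x : Octonion R) :
    (p + q).eval x = p.eval x + q.eval x :=
  Finsupp.sum_add_index' (fun _ => mul_zero _) (fun _ _ _ => mul_add _ _ _)

theorem eval_single (n : ℕ) (a x : Octonion R) :
    OrderedPoly.eval (Finsupp.single n a) x = OrderedPoly.power x n * a :=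
  Finsupp.sum_single_index (mul_zero _)

theorem coeff_toPoly (p : OrderedPoly (Octonion R)) (m : ℕ) :
    map (fun f : R[X] => f.coeff m) (toPoly p) = p m := by
  induction p using Finsupp.induction_linear with
  | zero => rw [toPoly_zero]; ext1 <;> simp [map, zero_def]
  | add f g hf hg =>
    rw [toPoly_add, Finsupp.add_apply, ← hf, ← hg]
    ext1 <;> simp [map, add_def]
  | single n a =>
    rw [toPoly_single, Finsupp.single_apply]
    split_ifs with h
    · subst h
      ext1 <;> simp [map, mul_def, ofScalar]
    · ext1 <;> simp [map, mul_def, ofScalar, coeff_X_pow, zero_def, Ne.symm h]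

/-- Division with remainder of an ordered polynomial by a characteristic polynomial, and the values
of the ordered polynomial at the octonions with that characteristic polynomial. -/
theorem exists_eval_eq (p : OrderedPoly (Octonion R)) (c n : R) :
    ∃ (A B : Octonion R) (Q : Octonion R[X]),
      toPoly p = ofScalar (charPoly c n) * Q + (map C A + ofScalar X * map C B) ∧
      ∀ q : Octonion R, q.x0 = c → normSq q = n → p.eval q = A + q * B := by
  induction p using Finsupp.induction_linear with
  | zero =>
    refine ⟨0, 0, 0, ?_, fun q _ _ => ?_⟩
    · simp [toPoly_zero, map_C_zero]
    · rw [mul_zero, add_zero]; exact Finsupp.sum_zero_index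
  | add f g hf hg =>
    obtain ⟨A, B, Q, h, h'⟩ := hf
    obtain ⟨A₁, B₁, Q₁, h₁, h₁'⟩ := hg
    refine ⟨A + A₁, B + B₁, Q + Q₁, ?_, fun q hc hn => ?_⟩
    · rw [toPoly_add, h, h₁, map_C_add, map_C_add, mul_add, mul_add]
      abel
    · rw [eval_add, h' q hc hn, h₁' q hc hn, mul_add]
      abel
  | single m a =>
    obtain ⟨α, β, g, hg, hq⟩ := exists_power_eq c n m
    refine ⟨ofScalar α * a, ofScalar β * a, ofScalar g * map C a, ?_, fun q hc hn => ?_⟩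
    · rw [toPoly_single, hg, map_C_ofScalar_mul, map_C_ofScalar_mul]
      ext1 <;> simp only [mul_def, add_def, ofScalar] <;> ring
    · rw [eval_single, hq q hc hn, add_mul_ofScalar_comm]

theorem normSq_division (Δ : R[X]) (A B : Octonion R) (Q : Octonion R[X]) :
    Δ ∣ normSq (ofScalar Δ * Q + (map C A + ofScalar X * map C B)) -
      (C (normSq A) + C (2 * dot A B) * X + C (normSq B) * X ^ 2) := by
  -- The quotient in the expansion `N(ΔQ + S) = Δ² N(Q) + 2Δ⟨Q,S⟩ + N(S)`.
  refine ⟨Δ * normSq Q + 2 * dot Q (map C A + ofScalar X * map C B), ?_⟩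
  have h1 : normSq (map C A + ofScalar X * map C B) =
      C (normSq A) + C (2 * dot A B) * X + C (normSq B) * X ^ 2 := by
    simp only [map, normSq, dot, mul_def, add_def, ofScalar, map_add, map_mul, map_pow, map_ofNat]
    ring
  have h2 (x : Octonion R[X]) : dot (ofScalar Δ * Q) x = Δ * dot Q x := by
    simp only [dot, mul_def, ofScalar]; ring
  rw [normSq_add, normSq_mul, normSq_ofScalar, h1, h2]
  ring

theorem charPoly_natDegree [Nontrivial R] (c n : R) : (charPoly c n).natDegree = 2 := by
  unfold charPoly; compute_degree!

theorem charPoly_monic (c n : R) : (charPoly c n).Monic := by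
  unfold charPoly; monicity!

theorem charPoly_coeff_zero (c n : R) : (charPoly c n).coeff 0 = n := by
  simp [charPoly]

theorem charPoly_coeff_one (c n : R) : (charPoly c n).coeff 1 = -(2 * c) := by
  simp [charPoly, coeff_X_pow, coeff_C]

theorem charPoly_dvd_linear_iff [IsDomain R] (c n a b : R) :
    charPoly c n ∣ C a + C b * X ↔ a = 0 ∧ b = 0 := by
  constructor
  · intro h
    have h0 := eq_zero_of_dvd_of_natDegree_lt h (by
      rw [charPoly_natDegree]
      exact lt_of_le_of_lt (by compute_degree : (C a + C b * X).natDegree ≤ 1) one_lt_two)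
    exact ⟨by simpa using congrArg (coeff · 0) h0, by simpa using congrArg (coeff · 1) h0⟩
  · rintro ⟨rfl, rfl⟩; simp

/-- Subtracting `d` times the divisor leaves a linear remainder, which must vanish. Applied to `N(A
+ XB)`, the conditions become `N(A) = n N(B)` and `⟨A,B⟩ = -c N(B)`. -/
theorem charPoly_dvd_quadratic_iff [IsDomain R] (c n a b d : R) :
    charPoly c n ∣ C a + C b * X + C d * X ^ 2 ↔ a = n * d ∧ b = -(2 * c * d) := by
  have h : C a + C b * X + C d * X ^ 2 =
      charPoly c n * C d + (C (a - n * d) + C (b + 2 * c * d) * X) := by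
    simp only [charPoly, map_add, map_mul, map_sub, map_ofNat]; ring
  rw [h, dvd_add_right (dvd_mul_right _ _), charPoly_dvd_linear_iff, sub_eq_zero,
    add_eq_zero_iff_eq_neg]

/-- The characteristic polynomial of a zero divides the norm of the ordered polynomial. -/
theorem charPoly_dvd_of_eval_eq_zero [IsDomain R] {p : OrderedPoly (Octonion R)} {z : Octonion R}
    (hz : p.eval z = 0) : charPoly z.x0 (normSq z) ∣ normSq (toPoly p) := by
  obtain ⟨A, B, Q, hQ, h⟩ := exists_eval_eq p z.x0 (normSq z)
  rw [h z rfl rfl, add_eq_zero_iff_eq_neg] at hz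
  have hdvd := normSq_division (charPoly z.x0 (normSq z)) A B Q
  rw [← hQ] at hdvd
  refine (dvd_iff_dvd_of_dvd_sub hdvd).mpr ((charPoly_dvd_quadratic_iff _ _ _ _ _).mpr ⟨?_, ?_⟩)
  · rw [hz, normSq_neg, normSq_mul]
  · rw [hz, dot_neg_mul]; ring

/-- Over an ordered field a sum of squares vanishes only trivially, so the leading terms of the
squared coordinates cannot cancel. -/
theorem coeff_normSq {P : Octonion R[X]} {d : ℕ} (h0 : P.x0.natDegree ≤ d)
    (h1 : P.x1.natDegree ≤ d) (h2 : P.x2.natDegree ≤ d) (h3 : P.x3.natDegree ≤ d)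
    (h4 : P.x4.natDegree ≤ d) (h5 : P.x5.natDegree ≤ d) (h6 : P.x6.natDegree ≤ d)
    (h7 : P.x7.natDegree ≤ d) :
    (normSq P).coeff (2 * d) = normSq (map (fun f : R[X] => f.coeff d) P) := by
  simp only [normSq, map, coeff_add, coeff_pow_of_natDegree_le h0, coeff_pow_of_natDegree_le h1,
    coeff_pow_of_natDegree_le h2, coeff_pow_of_natDegree_le h3, coeff_pow_of_natDegree_le h4,
    coeff_pow_of_natDegree_le h5, coeff_pow_of_natDegree_le h6, coeff_pow_of_natDegree_le h7]

/-- The octonions whose last four coordinates vanish. -/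
def IsQuaternionic (x : Octonion R) : Prop := x.x4 = 0 ∧ x.x5 = 0 ∧ x.x6 = 0 ∧ x.x7 = 0

/-- The divisor is real, so division acts on each coordinate separately and a zero coordinate has
zero remainder. -/
theorem isQuaternionic_of_division [IsDomain R] {c n : R} {A B : Octonion R} {P Q : Octonion R[X]}
    (h : P = ofScalar (charPoly c n) * Q + (map C A + ofScalar X * map C B))
    (h4 : P.x4 = 0) (h5 : P.x5 = 0) (h6 : P.x6 = 0) (h7 : P.x7 = 0) :
    IsQuaternionic A ∧ IsQuaternionic B := by
  have key (a b : R) (f : R[X]) (hf : charPoly c n * f + (C a + X * C b) = 0) : a = 0 ∧ b = 0 := by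
    refine (charPoly_dvd_linear_iff c n a b).mp ⟨-f, ?_⟩
    linear_combination hf
  obtain ⟨a4, b4⟩ := key A.x4 B.x4 Q.x4 (by
    rw [← h4, h]; simp [mul_def, add_def, ofScalar, map])
  obtain ⟨a5, b5⟩ := key A.x5 B.x5 Q.x5 (by
    rw [← h5, h]; simp [mul_def, add_def, ofScalar, map])
  obtain ⟨a6, b6⟩ := key A.x6 B.x6 Q.x6 (by
    rw [← h6, h]; simp [mul_def, add_def, ofScalar, map])
  obtain ⟨a7, b7⟩ := key A.x7 B.x7 Q.x7 (by
    rw [← h7, h]; simp [mul_def, add_def, ofScalar, map])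
  exact ⟨⟨a4, a5, a6, a7⟩, b4, b5, b6, b7⟩

end CommRing

/-! ### Zeros within a class and finiteness of the classes -/

section LinearOrderedField

variable {R : Type*} [Field R] [LinearOrder R] [IsStrictOrderedRing R]

theorem normSq_nonneg (x : Octonion R) : 0 ≤ normSq x := by
  unfold normSq; positivity

theorem sq_x0_le_normSq (x : Octonion R) : x.x0 ^ 2 ≤ normSq x := by
  unfold normSq
  linarith [sq_nonneg x.x1, sq_nonneg x.x2, sq_nonneg x.x3, sq_nonneg x.x4, sq_nonneg x.x5,
    sq_nonneg x.x6, sq_nonneg x.x7]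

theorem normSq_eq_zero {x : Octonion R} : normSq x = 0 ↔ x = 0 := by
  constructor
  · intro h
    unfold normSq at h
    have := sq_nonneg x.x0
    have := sq_nonneg x.x1
    have := sq_nonneg x.x2
    have := sq_nonneg x.x3
    have := sq_nonneg x.x4
    have := sq_nonneg x.x5
    have := sq_nonneg x.x6
    have := sq_nonneg x.x7
    ext <;> exact pow_eq_zero_iff two_ne_zero |>.mp (by linarith)
  · rintro rfl; simp [normSq, zero_def]

theorem mul_eq_zero_iff {x y : Octonion R} : x * y = 0 ↔ x = 0 ∨ y = 0 := by
  rw [← normSq_eq_zero, normSq_mul, mul_eq_zero, normSq_eq_zero, normSq_eq_zero]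

theorem eq_ofScalar_of_normSq_eq {q : Octonion R} (h : normSq q = q.x0 ^ 2) :
    q = ofScalar q.x0 := by
  rw [← sub_eq_zero, ← normSq_eq_zero, normSq_sub_ofScalar _ _ rfl, h, sub_self]

open Polynomial

theorem charPoly_injective : Function.Injective fun s : R × R => charPoly s.1 s.2 := by
  rintro ⟨c, n⟩ ⟨c', n'⟩ h
  have h0 := congrArg (coeff · 0) h
  have h1 := congrArg (coeff · 1) h
  simp only [charPoly_coeff_zero, charPoly_coeff_one] at h0 h1
  exact Prod.ext (by simp only; linarith) h0

/-- If an ordered polynomial has two distinct zeros with the same real part and norm, then all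
octonions with that real part and norm are zeros. -/
theorem eval_eq_zero_of_two_zeros {p : OrderedPoly (Octonion R)} {z w : Octonion R}
    (hz : p.eval z = 0) (hw : p.eval w = 0) (hne : w ≠ z) (h0 : w.x0 = z.x0)
    (h1 : normSq w = normSq z) {q : Octonion R} (hq0 : q.x0 = z.x0) (hq1 : normSq q = normSq z) :
    p.eval q = 0 := by
  obtain ⟨A, B, Q, -, h⟩ := exists_eval_eq p z.x0 (normSq z)
  rw [h z rfl rfl] at hz
  rw [h w h0 h1] at hw
  -- Subtracting `A + zB = 0` from `A + wB = 0` leaves `(w - z)B = 0`.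
  have hB : B = 0 := by
    have : (w - z) * B = 0 := by
      rw [sub_mul, sub_eq_zero]
      exact add_left_cancel (hw.trans hz.symm)
    exact (mul_eq_zero_iff.mp this).resolve_left (sub_ne_zero.mpr hne)
  rw [h q hq0 hq1, hB, mul_zero]
  rwa [hB, mul_zero] at hz

theorem natDegree_normSq_toPoly_pos {p : OrderedPoly (Octonion R)} (hp : p.IsNonconstant) :
    0 < (normSq (toPoly p)).natDegree := by
  obtain ⟨n, hn, hpn⟩ := hp
  have hne : p.support.Nonempty := ⟨n, Finsupp.mem_support_iff.mpr hpn⟩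
  let d := p.support.max' hne
  have hd : 0 < d := hn.trans_le (p.support.le_max' n (Finsupp.mem_support_iff.mpr hpn))
  have hpd : p d ≠ 0 := Finsupp.mem_support_iff.mp (p.support.max'_mem hne)
  have hcoeff (m : ℕ) (hm : d < m) : map (fun f : R[X] => f.coeff m) (toPoly p) = 0 := by
    rw [coeff_toPoly]
    by_contra h
    exact absurd (p.support.le_max' m (Finsupp.mem_support_iff.mpr h)) (not_le.mpr hm)
  have hlead : (normSq (toPoly p)).coeff (2 * d) ≠ 0 := by
    rw [coeff_normSq, coeff_toPoly]
    · exact normSq_eq_zero.not.mpr hpd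
    all_goals refine natDegree_le_iff_coeff_eq_zero.mpr fun m hm => ?_
    · exact congrArg x0 (hcoeff m hm)
    · exact congrArg x1 (hcoeff m hm)
    · exact congrArg x2 (hcoeff m hm)
    · exact congrArg x3 (hcoeff m hm)
    · exact congrArg x4 (hcoeff m hm)
    · exact congrArg x5 (hcoeff m hm)
    · exact congrArg x6 (hcoeff m hm)
    · exact congrArg x7 (hcoeff m hm)
  have := le_natDegree_of_ne_zero hlead
  omega

/-- A nonzero polynomial over a field has finitely many monic divisors. -/
theorem _root_.Polynomial.finite_monic_dvd {K : Type*} [Field K] {f : K[X]} (hf : f ≠ 0) :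
    {g : K[X] | g.Monic ∧ g ∣ f}.Finite := by
  classical
  -- A monic divisor is the product of its normalized factors, a sub-multiset of those of `f`.
  refine (((UniqueFactorizationMonoid.normalizedFactors f).powerset.toFinset.finite_toSet).image
    Multiset.prod).subset ?_
  rintro g ⟨hg, hgf⟩
  refine ⟨UniqueFactorizationMonoid.normalizedFactors g, ?_, ?_⟩
  · simpa using (UniqueFactorizationMonoid.dvd_iff_normalizedFactors_le_normalizedFactors
      hg.ne_zero hf).mp hgf
  · rw [UniqueFactorizationMonoid.prod_normalizedFactors_eq hg.ne_zero, hg.normalize_eq_self]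

/-- Only finitely many pairs (real part, squared norm) are attained by zeros. -/
theorem finite_image_zeroLocus {p : OrderedPoly (Octonion R)} (hp : p.IsNonconstant) :
    ((fun z : Octonion R => (z.x0, normSq z)) '' p.zeroLocus).Finite := by
  have hne : normSq (toPoly p) ≠ 0 := fun h => by
    have := natDegree_normSq_toPoly_pos hp
    rw [h, natDegree_zero] at this
    exact lt_irrefl _ this
  refine ((Polynomial.finite_monic_dvd hne).preimage
    (charPoly_injective (R := R)).injOn).subset ?_
  rintro _ ⟨z, hz, rfl⟩
  exact ⟨charPoly_monic _ _, charPoly_dvd_of_eval_eq_zero hz⟩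

/-- If a characteristic polynomial divides the norm of an ordered polynomial with quaternionic
coefficients, then this ordered polynomial has a quaternionic zero. -/
theorem exists_eval_eq_zero_of_charPoly_dvd {p : OrderedPoly (Octonion R)}
    (hp : ∀ m, IsQuaternionic (p m)) {c r : R}
    (hdvd : charPoly c (c ^ 2 + r ^ 2) ∣ normSq (toPoly p)) :
    ∃ q : Octonion R, IsQuaternionic q ∧ p.eval q = 0 := by
  obtain ⟨A, B, Q, hQ, h⟩ := exists_eval_eq p c (c ^ 2 + r ^ 2)
  have hsub := normSq_division (charPoly c (c ^ 2 + r ^ 2)) A B Q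
  rw [← hQ] at hsub
  obtain ⟨hA, hAB⟩ := (charPoly_dvd_quadratic_iff _ _ _ _ _).mp
    ((dvd_iff_dvd_of_dvd_sub hsub).mp hdvd)
  have hcoeff (m : ℕ) : IsQuaternionic (map (fun f : R[X] => f.coeff m) (toPoly p)) := by
    rw [coeff_toPoly]; exact hp m
  obtain ⟨hqA, hqB⟩ := isQuaternionic_of_division hQ
    (Polynomial.ext fun m => (hcoeff m).1) (Polynomial.ext fun m => (hcoeff m).2.1)
    (Polynomial.ext fun m => (hcoeff m).2.2.1) (Polynomial.ext fun m => (hcoeff m).2.2.2)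
  by_cases hB : B = 0
  · rw [hB, (normSq_eq_zero (x := (0 : Octonion R))).mpr rfl, mul_zero, normSq_eq_zero] at hA
    -- Here `A = B = 0`, so any point of the class is a zero; `c + r e₁` is a quaternionic one.
    refine ⟨⟨c, r, 0, 0, 0, 0, 0, 0⟩, ⟨rfl, rfl, rfl, rfl⟩, ?_⟩
    rw [h _ rfl (by simp [normSq]), hA, hB, mul_zero, add_zero]
  · have hN : normSq B ≠ 0 := normSq_eq_zero.not.mpr hB
    have hdot : dot A B = -(c * normSq B) := by linarith
    -- The solution of `qB = -A`; the two divisibility conditions say precisely that it has real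
    -- part `c` and the right norm.
    refine ⟨ofScalar (-(normSq B)⁻¹) * (A * conj B), ?_, ?_⟩
    · obtain ⟨a4, a5, a6, a7⟩ := hqA
      obtain ⟨b4, b5, b6, b7⟩ := hqB
      simp [IsQuaternionic, mul_def, ofScalar, conj, a4, a5, a6, a7, b4, b5, b6, b7]
    · rw [h]
      · rw [ofScalar_mul_mul_conj_mul, neg_mul, inv_mul_cancel₀ hN]
        ext <;> simp [add_def, mul_def, ofScalar, zero_def]
      · rw [x0_ofScalar_mul_mul_conj, hdot]
        field_simp
      · rw [normSq_mul, normSq_mul, normSq_ofScalar, normSq_conj, hA]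
        field_simp

end LinearOrderedField

end Octonion

/-! ### Distances between classes, and disjointness of spheres -/

namespace Octonion

theorem normSq_eq_add_sub {R : Type*} [CommRing R] (w z : Octonion R) :
    normSq w = normSq z + 2 * dot (w - z) z + normSq (w - z) := by
  simp only [normSq, dot, sub_def]; ring

section LinearOrderedField

variable {R : Type*} [Field R] [LinearOrder R] [IsStrictOrderedRing R]

/-- Expand `N(x/δ - y) ≥ 0`. This weighted inequality replaces Cauchy–Schwarz and needs no square
roots. -/
theorem two_mul_dot_le (x y : Octonion R) {δ : R} (hδ : 0 < δ) :
    2 * dot x y ≤ normSq x / δ + δ * normSq y := by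
  have h : 0 ≤ normSq (ofScalar δ⁻¹ * x + -y) := normSq_nonneg _
  have hd : dot (ofScalar δ⁻¹ * x) (-y) = -(δ⁻¹ * dot x y) := by
    simp only [dot, mul_def, neg_def, ofScalar]; ring
  rw [normSq_add, normSq_mul, normSq_ofScalar, normSq_neg, hd] at h
  have h2 := mul_nonneg hδ.le h
  have h3 : δ * (δ⁻¹ ^ 2 * normSq x + 2 * -(δ⁻¹ * dot x y) + normSq y) =
      normSq x / δ + δ * normSq y - 2 * dot x y := by
    field_simp
    ring
  linarith

/-- An octonion has positive distance to every set of octonions of a different norm. -/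
theorem exists_radius_of_normSq_ne (z : Octonion R) {n : R} (hn : n ≠ normSq z) :
    ∃ r : R, 0 < r ∧ ∀ w : Octonion R, normSq w = n → ¬ normSq (w - z) < r ^ 2 := by
  have hm : 0 < |n - normSq z| := abs_pos.mpr (sub_ne_zero.mpr hn)
  have hz := normSq_nonneg z
  set m := |n - normSq z| with hm_def
  -- Chosen so that `δ N(z) < m/2`; the `+ 1` covers `z = 0`.
  set δ := m / (2 * (normSq z + 1)) with hδ_def
  have hδ : 0 < δ := by positivity
  have hδz : δ * normSq z < m / 2 := by
    have : δ * (normSq z + 1) = m / 2 := by rw [hδ_def]; field_simp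
    linarith
  have hk : 0 < 1 + 1 / δ := by positivity
  -- If `N(w - z) < η`, the remaining part of the bound on `|N(w) - N(z)|` is also below `m/2`.
  set η := m / 2 / (1 + 1 / δ) with hη_def
  have hη : 0 < η := by positivity
  have hηm : η * (1 + 1 / δ) = m / 2 := by rw [hη_def]; field_simp
  -- Capping the radius at `1` gives `r² ≤ r ≤ η`, again without a square root.
  refine ⟨min η 1, lt_min hη one_pos, fun w hw hlt => ?_⟩
  have hlt' : normSq (w - z) < η := by
    refine hlt.trans_le ?_
    have h1 : min η 1 ≤ 1 := min_le_right _ _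
    have h0 : 0 ≤ min η 1 := (lt_min hη one_pos).le
    calc min η 1 ^ 2 ≤ min η 1 := by rw [sq]; exact mul_le_of_le_one_right h0 h1
      _ ≤ η := min_le_left _ _
  have hN := normSq_nonneg (w - z)
  have heq := normSq_eq_add_sub w z
  rw [hw] at heq
  have hup := two_mul_dot_le (w - z) z hδ
  have hlow := two_mul_dot_le (-(w - z)) z hδ
  have hneg : dot (-(w - z)) z = -dot (w - z) z := by simp only [dot, neg_def]; ring
  rw [normSq_neg, hneg] at hlow
  have hmle : m ≤ normSq (w - z) * (1 + 1 / δ) + δ * normSq z := by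
    have : normSq (w - z) * (1 + 1 / δ) = normSq (w - z) + normSq (w - z) / δ := by ring
    rw [hm_def, this]
    exact abs_le.mpr ⟨by linarith, by linarith⟩
  have := mul_lt_mul_of_pos_right hlt' hk
  linarith

/-- If the real parts differ, their difference bounds the distance from below; otherwise the norms
differ. -/
theorem exists_radius_of_ne (z : Octonion R) {s : R × R} (hs : s ≠ (z.x0, normSq z)) :
    ∃ r : R, 0 < r ∧ ∀ w : Octonion R, (w.x0, normSq w) = s → ¬ normSq (w - z) < r ^ 2 := by
  by_cases hc : s.1 = z.x0
  · obtain ⟨r, hr, h⟩ := exists_radius_of_normSq_ne z (n := s.2) (fun hn => hs (Prod.ext hc hn))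
    exact ⟨r, hr, fun w hw => h w (congrArg Prod.snd hw)⟩
  · refine ⟨|s.1 - z.x0|, abs_pos.mpr (sub_ne_zero.mpr hc), fun w hw => not_lt.mpr ?_⟩
    rw [sq_abs, ← hw]
    exact sq_x0_le_normSq (w - z)

/-- A common radius for finitely many pairs (real part, squared norm). -/
theorem exists_radius_of_finite (z : Octonion R) {F : Set (R × R)} (hF : F.Finite) :
    ∃ r : R, 0 < r ∧ ∀ w : Octonion R, (w.x0, normSq w) ∈ F →
      (w.x0, normSq w) ≠ (z.x0, normSq z) → ¬ normSq (w - z) < r ^ 2 := by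
  induction F, hF using Set.Finite.induction_on with
  | empty => exact ⟨1, one_pos, fun w hw => absurd hw (Set.notMem_empty _)⟩
  | @insert s F _ _ ih =>
    obtain ⟨r, hr, h⟩ := ih
    by_cases hs : s = (z.x0, normSq z)
    · refine ⟨r, hr, fun w hw hne => ?_⟩
      rcases hw with hw | hw
      · exact absurd (hw.trans hs) hne
      · exact h w hw hne
    · obtain ⟨r', hr', h'⟩ := exists_radius_of_ne z hs
      refine ⟨min r r', lt_min hr hr', fun w hw hne hlt => ?_⟩
      have h0 : 0 ≤ min r r' := (lt_min hr hr').le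
      rcases hw with hw | hw
      · exact h' w hw (hlt.trans_le (pow_le_pow_left₀ h0 (min_le_right _ _) 2))
      · exact h w hw hne (hlt.trans_le (pow_le_pow_left₀ h0 (min_le_left _ _) 2))

theorem mem_octonionSphere {c r : R} {q : Octonion R} :
    q ∈ octonionSphere c r ↔ q.x0 = c ∧ normSq q = c ^ 2 + r ^ 2 := by
  constructor
  · rintro ⟨h0, h1⟩
    rw [normSq_sub_ofScalar c q h0] at h1
    exact ⟨h0, by linarith⟩
  · rintro ⟨h0, h1⟩
    exact ⟨h0, by rw [normSq_sub_ofScalar c q h0, h1]; ring⟩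

theorem octonionSphere_disjoint {s t : R × R} (hs : 0 < s.2) (ht : 0 < t.2) (hst : s ≠ t) :
    Disjoint (octonionSphere s.1 s.2) (octonionSphere t.1 t.2) := by
  refine Set.disjoint_left.mpr fun q hqs hqt => hst ?_
  rw [mem_octonionSphere] at hqs hqt
  have hc : s.1 = t.1 := hqs.1.symm.trans hqt.1
  have hr : s.2 ^ 2 = t.2 ^ 2 := by
    have := hqs.2.symm.trans hqt.2
    rw [hc] at this
    linarith
  exact Prod.ext hc ((pow_left_inj₀ hs.le ht.le two_ne_zero).mp hr)

end LinearOrderedField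

/-! ### The octonionic zero locus, and real factors of the norm -/

section RealClosed

variable {R : Type*} [Field R] [LinearOrder R] [IsStrictOrderedRing R] [IsRealClosed R]

/-- Two distinct zeros with the same real part and norm lie on a sphere of zeros. -/
theorem exists_octonionSphere_subset {p : OrderedPoly (Octonion R)} {z w : Octonion R}
    (hz : z ∈ p.zeroLocus) (hw : w ∈ p.zeroLocus) (hne : w ≠ z)
    (hwz : (w.x0, normSq w) = (z.x0, normSq z)) :
    ∃ r : R, 0 < r ∧ octonionSphere z.x0 r ⊆ p.zeroLocus ∧ z ∈ octonionSphere z.x0 r := by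
  obtain ⟨h0, h1⟩ := Prod.mk.inj hwz
  obtain ⟨s, hs⟩ := IsRealClosed.exists_eq_pow_of_nonneg (x := normSq z - z.x0 ^ 2)
    (sub_nonneg.mpr (sq_x0_le_normSq z)) two_ne_zero
  -- If the imaginary part of `z` had norm zero, `z` and `w` would both be the real point `c`.
  have hs0 : s ≠ 0 := by
    rintro rfl
    have hz2 : normSq z = z.x0 ^ 2 := by linear_combination hs
    apply hne
    rw [eq_ofScalar_of_normSq_eq hz2, eq_ofScalar_of_normSq_eq (by rw [h1, hz2, h0] :
      normSq w = w.x0 ^ 2), h0]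
  have hnorm : normSq z = z.x0 ^ 2 + |s| ^ 2 := by rw [sq_abs, ← hs]; ring
  refine ⟨|s|, abs_pos.mpr hs0, fun q hq => ?_, mem_octonionSphere.mpr ⟨rfl, hnorm⟩⟩
  obtain ⟨hq0, hq1⟩ := mem_octonionSphere.mp hq
  exact eval_eq_zero_of_two_zeros hz hw hne h0 h1 hq0 (hq1.trans hnorm.symm)

/-- The zero locus of a non-constant octonionic ordered polynomial. -/
theorem isFiniteUnionOfPointsAndSpheres_zeroLocus {p : OrderedPoly (Octonion R)}
    (hp : p.IsNonconstant) :
    IsFiniteUnionOfPointsAndSpheres (normSq (R := R)) octonionSphere p.zeroLocus := by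
  have hF := finite_image_zeroLocus hp
  -- `S` collects all spheres contained in the locus, `P` the zeros on none of them; by the previous
  -- lemma a point of `P` is the only zero in its class.
  let S : Set (R × R) := {s | 0 < s.2 ∧ octonionSphere s.1 s.2 ⊆ p.zeroLocus}
  let P : Set (Octonion R) := {z ∈ p.zeroLocus | ∀ s ∈ S, z ∉ octonionSphere s.1 s.2}
  have huniq : ∀ z ∈ P, ∀ w ∈ p.zeroLocus, (w.x0, normSq w) = (z.x0, normSq z) → w = z := by
    intro z hz w hw hwz
    by_contra hne
    obtain ⟨r, hr, hsub, hmem⟩ := exists_octonionSphere_subset hz.1 hw hne hwz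
    exact hz.2 (z.x0, r) ⟨hr, hsub⟩ hmem
  have hS : S.Finite := by
    -- Each sphere is sent to its class, and positivity of the radii makes this injective.
    refine Set.Finite.of_finite_image (f := fun s : R × R => (s.1, s.1 ^ 2 + s.2 ^ 2))
      (hF.subset ?_) ?_
    · rintro _ ⟨s, hs, rfl⟩
      refine ⟨⟨s.1, s.2, 0, 0, 0, 0, 0, 0⟩, hs.2 (mem_octonionSphere.mpr ⟨rfl, ?_⟩), ?_⟩ <;>
        simp [normSq]
    · intro s hs t ht hst
      obtain ⟨h1, h2⟩ := Prod.mk.inj hst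
      rw [h1] at h2
      exact Prod.ext h1 ((pow_left_inj₀ hs.1.le ht.1.le two_ne_zero).mp (add_left_cancel h2))
  have hP : P.Finite := by
    refine Set.Finite.of_finite_image (f := fun z : Octonion R => (z.x0, normSq z))
      (hF.subset (Set.image_mono fun z hz => hz.1)) ?_
    exact fun z hz w hw h => huniq w hw z hz.1 h
  refine ⟨hP.toFinset, hS.toFinset, ?_, ?_, ?_, ?_⟩
  · intro z hz
    rw [Set.Finite.mem_toFinset] at hz
    obtain ⟨r, hr, h⟩ := exists_radius_of_finite z hF
    refine ⟨hz.1, r, hr, fun w hw hlt => ?_⟩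
    by_contra hne
    exact h w ⟨w, hw, rfl⟩ (fun heq => hne (huniq z hz w hw heq)) hlt
  · intro s hs
    exact ((Set.Finite.mem_toFinset hS).mp hs).1
  · intro s hs t ht hst
    rw [Set.Finite.coe_toFinset] at hs ht
    exact octonionSphere_disjoint hs.1 ht.1 hst
  · ext z
    simp only [Set.Finite.coe_toFinset, Set.Finite.mem_toFinset, Set.mem_union, Set.mem_iUnion,
      exists_prop]
    constructor
    · intro hz
      by_cases h : ∃ s ∈ S, z ∈ octonionSphere s.1 s.2
      · exact Or.inr h
      · push Not at h
        exact Or.inl ⟨hz, h⟩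
    · rintro (hz | ⟨s, hs, hz⟩)
      · exact hz.1
      · exact hs.2 hz

open Polynomial

/-- The norm of an ordered polynomial, if it is not constant, is divisible by a characteristic
polynomial. -/
theorem exists_charPoly_dvd {P : Octonion R[X]} (hP : 0 < (normSq P).natDegree) :
    ∃ c r : R, charPoly c (c ^ 2 + r ^ 2) ∣ normSq P := by
  obtain ⟨g, hmon, hirr, hg⟩ :=
    exists_monic_irreducible_factor (normSq P) (not_isUnit_of_natDegree_pos _ hP)
  have hpos := hirr.natDegree_pos
  have hle := IsRealClosed.natDegree_le_two_of_irreducible hirr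
  -- At a real root of this sum of squares every coordinate of `P` vanishes, so the root is at least
  -- double and `(X - c)²` divides.
  have hroot : ∀ c : R, (normSq P).IsRoot c → charPoly c (c ^ 2 + 0 ^ 2) ∣ normSq P := by
    intro c hc
    have hev : normSq (map (eval c) P) = 0 := by
      rw [← hc.eq_zero]
      simp [normSq, map]
    rw [normSq_eq_zero] at hev
    have hsq (f : R[X]) (hf : f.eval c = 0) : charPoly c (c ^ 2 + 0 ^ 2) ∣ f ^ 2 := by
      have : charPoly c (c ^ 2 + 0 ^ 2) = (X - C c) ^ 2 := by
        simp only [charPoly, map_mul, map_add, map_pow, map_ofNat, map_zero]; ring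
      rw [this]
      exact pow_dvd_pow_of_dvd (dvd_iff_isRoot.mpr hf) 2
    unfold normSq
    exact dvd_add (dvd_add (dvd_add (dvd_add (dvd_add (dvd_add (dvd_add
      (hsq _ (congrArg x0 hev)) (hsq _ (congrArg x1 hev))) (hsq _ (congrArg x2 hev)))
      (hsq _ (congrArg x3 hev))) (hsq _ (congrArg x4 hev))) (hsq _ (congrArg x5 hev)))
      (hsq _ (congrArg x6 hev))) (hsq _ (congrArg x7 hev))
  by_cases hex : ∃ c, (normSq P).IsRoot c
  · obtain ⟨c, hc⟩ := hex
    exact ⟨c, 0, hroot c hc⟩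
  have hdeg : g.natDegree = 2 := by
    by_contra hne
    obtain ⟨c, hc⟩ := exists_root_of_degree_eq_one
      ((degree_eq_iff_natDegree_eq_of_pos one_pos).mpr (by omega : g.natDegree = 1))
    exact hex ⟨c, hc.dvd hg⟩
  have hgeq : g = charPoly (-(g.coeff 1) / 2) (g.coeff 0) := by
    have h2 : g.coeff 2 = 1 := by rw [← hdeg]; exact hmon
    conv_lhs => rw [g.as_sum_range_C_mul_X_pow, hdeg]
    simp only [Finset.sum_range_succ, Finset.sum_range_zero, h2, charPoly]
    rw [mul_div_cancel₀ _ (two_ne_zero (α := R))]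
    simp only [map_neg, map_one]
    ring
  obtain ⟨c, n, hgc⟩ : ∃ c n : R, g = charPoly c n := ⟨_, _, hgeq⟩
  rcases le_total (c ^ 2) n with hcn | hcn
  · obtain ⟨r, hr⟩ := IsRealClosed.exists_eq_pow_of_nonneg (sub_nonneg.mpr hcn) two_ne_zero
    refine ⟨c, r, ?_⟩
    rwa [← hr, add_sub_cancel, ← hgc]
  -- In this case `c + √(c² - n)` would be a real root, which has been excluded.
  · obtain ⟨r, hr⟩ := IsRealClosed.exists_eq_pow_of_nonneg (sub_nonneg.mpr hcn) two_ne_zero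
    refine absurd ⟨c + r, IsRoot.dvd ?_ hg⟩ hex
    rw [hgc, IsRoot, charPoly]
    simp only [Polynomial.eval_add, eval_sub, eval_pow, eval_mul, eval_X, eval_C]
    linear_combination -hr

end RealClosed

end Octonion

/-! ### Quaternions as a subalgebra of the octonions -/

namespace Quaternion

section CommRing

variable {R : Type*} [CommRing R]

/-- The embedding of the quaternions in the octonions with `i, j, k ↦ e₁, e₂, e₃`. -/
def toOctonion : Quaternion R →+ Octonion R where
  toFun q := ⟨q.re, q.imI, q.imJ, q.imK, 0, 0, 0, 0⟩
  map_zero' := by ext <;> simp [Octonion.zero_def]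
  map_add' a b := by ext <;> simp [Octonion.add_def]

theorem toOctonion_apply (q : Quaternion R) :
    toOctonion q = ⟨q.re, q.imI, q.imJ, q.imK, 0, 0, 0, 0⟩ := rfl

theorem toOctonion_injective : Function.Injective (toOctonion (R := R)) := by
  intro a b h
  simp only [toOctonion_apply, Octonion.mk.injEq] at h
  ext <;> tauto

theorem toOctonion_mul (a b : Quaternion R) :
    toOctonion (a * b) = toOctonion a * toOctonion b := by
  ext <;> simp [toOctonion_apply, Octonion.mul_def]

theorem toOctonion_one : toOctonion (1 : Quaternion R) = 1 := by
  ext <;> simp [toOctonion_apply, Octonion.one_def]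

theorem normSq_toOctonion (q : Quaternion R) : Octonion.normSq (toOctonion q) = normSq q := by
  simp [toOctonion_apply, Octonion.normSq, normSq_def']

theorem toOctonion_coe (c : R) : toOctonion (c : Quaternion R) = Octonion.ofScalar c := by
  simp [toOctonion_apply, Octonion.ofScalar]

theorem preimage_octonionSphere (c r : R) :
    toOctonion ⁻¹' octonionSphere c r = quaternionSphere c r := by
  ext q
  simp only [octonionSphere, quaternionSphere, Set.mem_preimage, Set.mem_ofPred_eq,
    ← toOctonion_coe, ← map_sub, normSq_toOctonion]
  rfl

theorem toOctonion_power (q : Quaternion R) (n : ℕ) :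
    toOctonion (OrderedPoly.power q n) = OrderedPoly.power (toOctonion q) n := by
  induction n with
  | zero => exact toOctonion_one
  | succ n ih => rw [OrderedPoly.power, OrderedPoly.power, toOctonion_mul, ih]

/-- The octonionic ordered polynomial with the coefficients of a quaternionic one. -/
noncomputable def polyToOctonion (p : OrderedPoly (Quaternion R)) : OrderedPoly (Octonion R) :=
  p.mapRange toOctonion (map_zero _)

theorem eval_polyToOctonion (p : OrderedPoly (Quaternion R)) (q : Quaternion R) :
    (polyToOctonion p).eval (toOctonion q) = toOctonion (p.eval q) := by
  rw [OrderedPoly.eval, OrderedPoly.eval, polyToOctonion,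
    Finsupp.sum_mapRange_index (fun _ => mul_zero _), map_finsuppSum]
  simp only [toOctonion_mul, toOctonion_power]

theorem zeroLocus_eq_preimage (p : OrderedPoly (Quaternion R)) :
    p.zeroLocus = toOctonion ⁻¹' (polyToOctonion p).zeroLocus := by
  ext q
  simp only [OrderedPoly.zeroLocus, Set.mem_preimage, Set.mem_ofPred_eq, eval_polyToOctonion]
  exact (map_eq_zero_iff _ toOctonion_injective).symm

theorem isNonconstant_polyToOctonion {p : OrderedPoly (Quaternion R)} (hp : p.IsNonconstant) :
    (polyToOctonion p).IsNonconstant := by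
  obtain ⟨n, hn, h⟩ := hp
  refine ⟨n, hn, ?_⟩
  rw [polyToOctonion, Finsupp.mapRange_apply]
  exact (map_ne_zero_iff _ toOctonion_injective).mpr h

end CommRing

/-- The embedding is injective and isometric, so isolation survives restriction, and a 6-sphere with
real center meets the quaternions in the 2-sphere with the same center and radius. -/
theorem isFiniteUnionOfPointsAndSpheres_preimage {R : Type*} [Field R] [LinearOrder R]
    {Z : Set (Octonion R)}
    (h : IsFiniteUnionOfPointsAndSpheres (Octonion.normSq (R := R)) octonionSphere Z) :
    IsFiniteUnionOfPointsAndSpheres (fun q : Quaternion R => normSq q) quaternionSphere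
      (toOctonion ⁻¹' Z) := by
  obtain ⟨P, S, hP, hS, hdisj, hZ⟩ := h
  refine ⟨P.preimage toOctonion toOctonion_injective.injOn, S, ?_, hS, ?_, ?_⟩
  · intro z hz
    obtain ⟨hzZ, r, hr, h⟩ := hP _ (Finset.mem_preimage.mp hz)
    refine ⟨hzZ, r, hr, fun w hw hlt => toOctonion_injective (h _ hw ?_)⟩
    rwa [← map_sub, normSq_toOctonion]
  · intro s hs t ht hst
    simp only [Function.onFun, ← preimage_octonionSphere]
    exact (hdisj hs ht hst).preimage _
  · conv_lhs => rw [hZ]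
    simp only [Set.preimage_union, Set.preimage_iUnion, preimage_octonionSphere,
      Finset.coe_preimage]

/-- A non-constant quaternionic ordered polynomial over a real closed field has a zero. -/
theorem zeroLocus_nonempty {R : Type*} [Field R] [LinearOrder R] [IsStrictOrderedRing R]
    [IsRealClosed R] {p : OrderedPoly (Quaternion R)} (hp : p.IsNonconstant) :
    p.zeroLocus.Nonempty := by
  obtain ⟨c, r, h⟩ := Octonion.exists_charPoly_dvd
    (Octonion.natDegree_normSq_toPoly_pos (isNonconstant_polyToOctonion hp))
  obtain ⟨q, ⟨h4, h5, h6, h7⟩, hq⟩ := Octonion.exists_eval_eq_zero_of_charPoly_dvd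
    (p := polyToOctonion p) (fun _ => ⟨rfl, rfl, rfl, rfl⟩) h
  obtain ⟨x, rfl⟩ : ∃ x : Quaternion R, toOctonion x = q :=
    ⟨⟨q.x0, q.x1, q.x2, q.x3⟩, Octonion.ext rfl rfl rfl rfl h4.symm h5.symm h6.symm h7.symm⟩
  refine ⟨x, ?_⟩
  rw [zeroLocus_eq_preimage]
  exact hq

end Quaternion

theorem mainTheorem5 {R : Type*} [Field R] [LinearOrder R] [IsStrictOrderedRing R]
    [IsRealClosed R] :
    (∀ p : OrderedPoly (Quaternion R), p.IsNonconstant →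
      p.zeroLocus.Nonempty ∧
      IsFiniteUnionOfPointsAndSpheres (fun q : Quaternion R => Quaternion.normSq q)
        quaternionSphere p.zeroLocus) ∧
    (∀ p : OrderedPoly (Octonion R), p.IsNonconstant →
      IsFiniteUnionOfPointsAndSpheres (Octonion.normSq (R := R))
        octonionSphere p.zeroLocus) := by
  refine ⟨fun p hp => ⟨Quaternion.zeroLocus_nonempty hp, ?_⟩,
    fun p hp => Octonion.isFiniteUnionOfPointsAndSpheres_zeroLocus hp⟩
  rw [Quaternion.zeroLocus_eq_preimage]
  exact Quaternion.isFiniteUnionOfPointsAndSpheres_preimage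
    (Octonion.isFiniteUnionOfPointsAndSpheres_zeroLocus
      (Quaternion.isNonconstant_polyToOctonion hp))
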